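/- Let $q$ be a prime power and let $\mathbb F=\mathbb F_q$. For $n\ge 0$ let $B_q(n)$ be the set of subspaces of the column space $\mathbb F^n$. Identify $\mathbb F^n$ with the vectors of $\mathbb F^{n+1}$ whose last component is $0$, so that $B_q(n)\subseteq B_q(n+1)$, and put $A_q(n+1)=B_q(n+1)\setminus B_q(n)$. For $Y\in A_q(n+1)$ let $Y^r=Y\cap\mathbb F^n\in B_q(n)$. Let $\mathbb C[B_q(n)]$ be the complex vector space with basis $B_q(n)$, write $v=\sum_Y v(Y)\,Y$ for its elements, and set $$\langle u,v\rangle_n=\sum_{X\in B_q(n)}\overline{u(X)}\,v(X)\,\frac{q^{\binom{\dim X}{2}}}{\prod_{i=0}^{n-1}(1+q^i)} .$$ Let $\theta_n:\mathbb C[B_q(n)]\to\mathbb C[B_q(n+1)]$ be the linear map that sends $X\in B_q(n)$ to the sum of all $Y\in A_q(n+1)$ covering $X$ (in the inclusion order). For $X\in B_q(n)$ let $\widehat X\in A_q(n+1)$ be the span of $X$ and the last standard basis vector $e_{n+1}$. Let $H(n+1)$ be the group of all matrices $\begin{pmatrix} I_n& a\\ 0&1\end{pmatrix}$, $a\in\mathbb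 F^n$, acting on $B_q(n+1)$; let $\mathcal N_q(n)$ be the set of its nontrivial (degree one) irreducible characters, and for $\chi\in\mathcal N_q(n)$ let $p(\chi)=\sum_{g\in H(n+1)}\overline{\chi(g)}\,g$. For $n\ge1$ and $\chi\in\mathcal N_q(n)$ there is a unique $(n-1)$-dimensional subspace $X(\chi)$ of $\mathbb F^n$ with $p(\chi)(\widehat{X(\chi)})\ne0$. For $X=X(\chi)$ let $M(X)$ be the unique $n\times(n-1)$ matrix with column space $X$ in Schubert normal form: the last nonzero entry of column $j$ is a $1$, in row $r_j$ say, $r_1<\dots<r_{n-1}$, and rows $r_1,\dots,r_{n-1}$ of $M(X)$ form the identity matrix. Let $\tau(X):\mathbb F^{n-1}\to X$ be the isomorphism sending $e_j$ to column $j$ of $M(X)$. Let $\mathcal E_q(0)=\{()\}$, and for $n\ge1$ let $\mathcal E_q(n)$ consist of the sequences $(\beta,0)$ and $(\beta,1)$ with $\beta\in\mathcal E_q(n-1)$ and, if $n\ge2$, the sequences $(\beta,\chi)$ with $\beta\in\mathcal E_q(n-2)$ and $\chi\in\mathcal N_q(n-1)$; here $(\beta,x)$ is $\beta$ with $x$ appended.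 Let $N(\alpha)$ be the number of nonzero entries of $\alpha$ (characters count as nonzero), and let $\overline\alpha$ be obtained from $\alpha$ by interchanging $0$s and $1$s. Define $v_\alpha\in\mathbb C[B_q(n)]$ for $\alpha\in\mathcal E_q(n)$ recursively by $v_{()}=\{0\}$; for $\beta\in\mathcal E_q(n)$ with $N(\beta)=k$, $$v_{(\beta,0)}=q^kv_\beta+\theta_n(v_\beta),\qquad v_{(\beta,1)}=q^{n-k}v_\beta-\theta_n(v_\beta);$$ and for $n\ge1$, $\beta\in\mathcal E_q(n-1)$, $\chi\in\mathcal N_q(n)$, $X=X(\chi)$, $$v_{(\beta,\chi)}=\sum_{Z\in B_q(n-1)}v_\beta(Z)\,q^{-\dim Z}\,p(\chi)\bigl(\widehat{\tau(X)(Z)}\bigr)\in\mathbb C[B_q(n+1)].$$ Then the following hold. (a) Let $n\ge0$ and $\beta\in\mathcal E_q(n)$ with $N(\beta)=k$. (i) If $\alpha=(\beta,0)$ then, for $Y\in B_q(n+1)$, $$v_\alpha(Y)=\begin{cases}q^k\,v_\beta(Y)&\text{if }Y\in B_q(n),\\ v_\beta(Y^r)&\text{if }Y\in A_q(n+1),\end{cases}\qquad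 \langle v_\alpha,v_\alpha\rangle_{n+1}=\frac{q^n+q^{2k}}{1+q^n}\,\langle v_\beta,v_\beta\rangle_n .$$ (ii) If $\alpha=(\beta,1)$ then, for $Y\in B_q(n+1)$, $$v_\alpha(Y)=\begin{cases}q^{n-k}\,v_\beta(Y)&\text{if }Y\in B_q(n),\\ -v_\beta(Y^r)&\text{if }Y\in A_q(n+1),\end{cases}\qquad \langle v_\alpha,v_\alpha\rangle_{n+1}=\frac{q^n+q^{2(n-k)}}{1+q^n}\,\langle v_\beta,v_\beta\rangle_n .$$ (b) Let $n\ge1$, $\beta\in\mathcal E_q(n-1)$, $\chi\in\mathcal N_q(n)$, $\alpha=(\beta,\chi)\in\mathcal E_q(n+1)$ and $X=X(\chi)$. Then, for $Y\in B_q(n+1)$, $$|v_\alpha(Y)|=\begin{cases}0&\text{if }Y\in B_q(n),\\ |v_\beta(\tau(X)^{-1}(Y^r))|&\text{if }Y\in A_q(n+1)\text{ and }Y^r\subseteq X,\\ 0&\text{if }Y\in A_q(n+1)\text{ and }Y^r\not\subseteq X,\end{cases}$$ $$\langle v_\alpha,v_\alpha\rangle_{n+1}=\frac{q^n}{(1+q^{n-1})(1+q^n)}\,\langle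 v_\beta,v_\beta\rangle_{n-1}.$$ (c) For all $n\ge0$, $\alpha\in\mathcal E_q(n)$ and $Y\in B_q(n)$, $$|v_\alpha(Y)|=|v_{\overline\alpha}(Y)|,\qquad \langle v_\alpha,v_\alpha\rangle_n=\langle v_{\overline\alpha},v_{\overline\alpha}\rangle_n .$$ -/

import Mathlib

namespace QCube

open Module

universe u

variable {F : Type u} [Field F]

/-- `B_q(n)`: the subspaces of the space `F ^ n` of column vectors. -/
abbrev B (F : Type u) [Field F] (n : ℕ) : Type u := Submodule F (Fin n → F)

noncomputable instance instFintypeB [Fintype F] (n : ℕ) : Fintype (B F n) :=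
  have : Finite (B F n) := Finite.of_injective (fun X : B F n => (X : Set (Fin n → F)))
    SetLike.coe_injective
  Fintype.ofFinite _

/-- `q`, as a complex number. -/
noncomputable def q (F : Type u) [Fintype F] : ℂ := (Fintype.card F : ℂ)

/-- `ℂ[B_q(n)]`: the complex vector space with basis `B_q(n)`; the value `v Y` of an element `v`
is its coordinate at `Y`. -/
abbrev CB (F : Type u) [Field F] (n : ℕ) : Type u := B F n →₀ ℂ

/-- `P_q(n) = ∏_{k < n} (1 + q ^ k)`. -/
noncomputable def P (F : Type u) [Fintype F] (n : ℕ) : ℂ := ∏ k ∈ Finset.range n, (1 + q F ^ k)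

/-- The weight `π(X) = q ^ (k choose 2) / P_q(n)`, `k = dim X`. -/
noncomputable def weight [Fintype F] {n : ℕ} (X : B F n) : ℂ := q F ^ ((finrank F X).choose 2) / P F n

/-- The inner product `⟨u, v⟩_π` on `ℂ[B_q(n)]`, conjugate-linear in the first variable. -/
noncomputable def innerPi [Fintype F] {n : ℕ} (v w : CB F n) : ℂ :=
  ∑ X : B F n, starRingEnd ℂ (v X) * w X * weight X

/-- The identification of `F ^ n` with the vectors of `F ^ (n + 1)` whose last component is `0`. -/
def emb (F : Type u) [Field F] (n : ℕ) : (Fin n → F) →ₗ[F] (Fin (n + 1) → F) where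
  toFun x := Fin.snoc (α := fun _ => F) x 0
  map_add' x y := by
    funext i
    refine Fin.lastCases ?_ (fun j => ?_) i <;> simp
  map_smul' c x := by
    funext i
    refine Fin.lastCases ?_ (fun j => ?_) i <;> simp

/-- The hyperplane `F ^ n` of `F ^ (n + 1)`. -/
def hyper (F : Type u) [Field F] (n : ℕ) : B F (n + 1) := LinearMap.range (emb F n)

/-- `X ∈ B_q(n)` as an element of `B_q(n + 1)`. -/
def up {n : ℕ} (X : B F n) : B F (n + 1) := X.map (emb F n)

/-- `Y ∩ F ^ n`, as an element of `B_q(n)`. On subspaces of `F ^ n` this inverts `up`. -/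
def res {n : ℕ} (Y : B F (n + 1)) : B F n := Y.comap (emb F n)

/-- The inclusion of `ℂ[B_q(n)]` in `ℂ[B_q(n + 1)]`. -/
noncomputable def incl (n : ℕ) : CB F n →ₗ[ℂ] CB F (n + 1) :=
  Finsupp.linearCombination ℂ fun X => Finsupp.single (up X) 1

open Classical in
/-- `θ_n`: a subspace `X` of `F ^ n` goes to the sum of the subspaces of `F ^ (n + 1)` that
cover `X` and are not contained in `F ^ n`. -/
noncomputable def theta [Fintype F] (n : ℕ) : CB F n →ₗ[ℂ] CB F (n + 1) :=
  Finsupp.linearCombination ℂ fun X =>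
    ∑ Y ∈ Finset.univ.filter (fun Y : B F (n + 1) => up X ⋖ Y ∧ ¬ Y ≤ hyper F n),
      Finsupp.single Y (1 : ℂ)

/-- The last standard basis vector of `F ^ (n + 1)`. -/
def lastVec (F : Type u) [Field F] (n : ℕ) : Fin (n + 1) → F := Pi.single (Fin.last n) 1

/-- The span of `X` and the last standard basis vector. -/
def hat {n : ℕ} (X : B F n) : B F (n + 1) := up X ⊔ Submodule.span F {lastVec F n}

/-- The identity matrix of size `n + 1`, with its last column replaced by `(a, 1)`. -/
def phiMatrix {n : ℕ} (a : Fin n → F) : Matrix (Fin (n + 1)) (Fin (n + 1)) F :=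
  (1 : Matrix (Fin (n + 1)) (Fin (n + 1)) F).updateCol (Fin.last n)
    (Fin.snoc (α := fun _ => F) a 1)

theorem phiMatrix_eq {n : ℕ} (a : Fin n → F) :
    phiMatrix a = 1 + Matrix.vecMulVec (emb F n a) (lastVec F n) := by
  ext i j
  refine Fin.lastCases ?_ (fun i => ?_) i <;> refine Fin.lastCases ?_ (fun j => ?_) j <;>
    simp [phiMatrix, Matrix.vecMulVec_apply, emb, lastVec]

theorem phiMatrix_add {n : ℕ} (a b : Fin n → F) :
    phiMatrix (a + b) = phiMatrix a * phiMatrix b := by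
  have h : lastVec F n ⬝ᵥ emb F n b = 0 := by simp [lastVec, emb]
  simp only [phiMatrix_eq, mul_add, add_mul, Matrix.vecMulVec_mul_vecMulVec, h, map_add,
    Matrix.add_vecMulVec]
  simp
  abel

theorem phiMatrix_zero {n : ℕ} : phiMatrix (0 : Fin n → F) = 1 := by
  simp [phiMatrix_eq]

/-- The homomorphism `φ : F ^ n → GL(n + 1, F)`, `a ↦ [I a; 0 1]`. -/
def phi (F : Type u) [Field F] (n : ℕ) : Multiplicative (Fin n → F) →* GL (Fin (n + 1)) F where
  toFun a :=
    { val := phiMatrix a.toAdd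
      inv := phiMatrix (-a.toAdd)
      val_inv := by rw [← phiMatrix_add, add_neg_cancel, phiMatrix_zero]
      inv_val := by rw [← phiMatrix_add, neg_add_cancel, phiMatrix_zero] }
  map_one' := Units.ext phiMatrix_zero
  map_mul' a b := Units.ext (phiMatrix_add a.toAdd b.toAdd)

/-- The group `H(n + 1, F)` of the matrices `[I a; 0 1]`. -/
def H (F : Type u) [Field F] (n : ℕ) : Subgroup (GL (Fin (n + 1)) F) := (phi F n).range

noncomputable instance instFintypeH [Fintype F] (n : ℕ) : Fintype (H F n) :=
  have : Finite (H F n) := inferInstance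
  Fintype.ofFinite _

/-- The action of `H(n + 1, F)` on subspaces. -/
def act {n : ℕ} (g : H F n) (Y : B F (n + 1)) : B F (n + 1) :=
  Y.map (g : GL (Fin (n + 1)) F).val.mulVecLin

/-- `N_q(n)`: the nontrivial irreducible characters of the (abelian) group `H(n + 1, F)`, that is,
its nontrivial homomorphisms to the multiplicative group of `ℂ`. -/
abbrev N (F : Type u) [Field F] (n : ℕ) : Type u := {χ : H F n →* ℂˣ // χ ≠ 1}

/-- The operator `p(χ) = ∑_g conj (χ g) g`. -/
noncomputable def p [Fintype F] {n : ℕ} (χ : N F n) : CB F (n + 1) →ₗ[ℂ] CB F (n + 1) :=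
  Finsupp.linearCombination ℂ fun Y =>
    ∑ g : H F n, starRingEnd ℂ (χ.1 g : ℂ) • Finsupp.single (act g Y) (1 : ℂ)

/-! ### The hyperplane `X(χ)` -/

theorem phiMatrix_mulVec {n : ℕ} (a : Fin n → F) (x : Fin (n + 1) → F) :
    (phiMatrix a).mulVec x = x + x (Fin.last n) • emb F n a := by
  have h : lastVec F n ⬝ᵥ x = x (Fin.last n) := by simp [lastVec]
  rw [phiMatrix_eq, Matrix.add_mulVec, Matrix.one_mulVec, Matrix.vecMulVec_mulVec, h]
  simp

theorem emb_last {n : ℕ} (a : Fin n → F) : emb F n a (Fin.last n) = 0 := by simp [emb]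

theorem emb_injective (n : ℕ) : Function.Injective (emb F n) := by
  intro a b h
  funext i
  simpa [emb] using congrFun h i.castSucc

theorem emb_mem_hat {n : ℕ} {X : B F n} {a : Fin n → F} : emb F n a ∈ hat X ↔ a ∈ X := by
  constructor
  · intro h
    obtain ⟨y, hy, z, hz, hyz⟩ := Submodule.mem_sup.1 h
    obtain ⟨x, hx, rfl⟩ := hy
    obtain ⟨c, rfl⟩ := Submodule.mem_span_singleton.1 hz
    have hc : c = 0 := by simpa [emb_last, lastVec] using congrFun hyz (Fin.last n)
    rw [hc, zero_smul, add_zero] at hyz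
    exact emb_injective n hyz ▸ hx
  · exact fun h => Submodule.mem_sup_left (Submodule.mem_map_of_mem h)

theorem lastVec_mem_hat {n : ℕ} (X : B F n) : lastVec F n ∈ hat X :=
  Submodule.mem_sup_right (Submodule.mem_span_singleton_self _)

/-- The element `φ(a)` of `H(n + 1, F)`. -/
def phiH {n : ℕ} (a : Fin n → F) : H F n := ⟨phi F n (Multiplicative.ofAdd a), _, rfl⟩

theorem phiH_surjective {n : ℕ} (g : H F n) : ∃ a, phiH a = g := by
  obtain ⟨g, a, rfl⟩ := g
  exact ⟨a.toAdd, rfl⟩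

theorem phiH_add {n : ℕ} (a b : Fin n → F) : phiH (a + b) = phiH a * phiH b :=
  Subtype.ext (map_mul (phi F n) (Multiplicative.ofAdd a) (Multiplicative.ofAdd b))

theorem phiH_zero {n : ℕ} : phiH (0 : Fin n → F) = 1 :=
  Subtype.ext (map_one (phi F n))

theorem act_mul {n : ℕ} (g h : H F n) (Y : B F (n + 1)) : act (g * h) Y = act g (act h Y) := by
  simp only [act, Subgroup.coe_mul, Units.val_mul, Matrix.mulVecLin_mul, Submodule.map_comp]

theorem act_one {n : ℕ} (Y : B F (n + 1)) : act 1 Y = Y := by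
  simp [act]

theorem mem_act_phiH {n : ℕ} (a : Fin n → F) (Y : B F (n + 1)) {y : Fin (n + 1) → F}
    (hy : y ∈ Y) : y + y (Fin.last n) • emb F n a ∈ act (phiH a) Y :=
  ⟨y, hy, phiMatrix_mulVec a y⟩

theorem act_hat_eq_iff {n : ℕ} (a : Fin n → F) (X : B F n) :
    act (phiH a) (hat X) = hat X ↔ a ∈ X := by
  have key : ∀ b ∈ X, act (phiH b) (hat X) ≤ hat X := by
    rintro b hb _ ⟨y, hy, rfl⟩
    have : (phiMatrix b).mulVec y ∈ hat X := by
      rw [phiMatrix_mulVec]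
      exact add_mem hy (Submodule.smul_mem _ _ (emb_mem_hat.2 hb))
    exact this
  constructor
  · intro h
    have h1 := mem_act_phiH a (hat X) (lastVec_mem_hat X)
    rw [h] at h1
    have h2 := sub_mem h1 (lastVec_mem_hat X)
    simpa [lastVec, emb_mem_hat] using h2
  · intro ha
    refine le_antisymm (key a ha) ?_
    have h1 : act (phiH a) (act (phiH (-a)) (hat X)) ≤ act (phiH a) (hat X) :=
      Submodule.map_mono (key (-a) (neg_mem ha))
    rwa [← act_mul, ← phiH_add, add_neg_cancel, phiH_zero, act_one] at h1

theorem p_hat_ne_zero_iff [Fintype F] {n : ℕ} (χ : N F n) (X : B F n) :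
    p χ (Finsupp.single (hat X) 1) ≠ 0 ↔ ∀ a ∈ X, χ.1 (phiH a) = 1 := by
  classical
  have hp : p χ (Finsupp.single (hat X) 1) =
      ∑ g : H F n, starRingEnd ℂ (χ.1 g : ℂ) • Finsupp.single (act g (hat X)) (1 : ℂ) := by
    simp [p]
  constructor
  · intro h a ha
    by_contra hne
    apply h
    have h1 : p χ (Finsupp.single (hat X) 1) =
        starRingEnd ℂ (χ.1 (phiH a) : ℂ) • p χ (Finsupp.single (hat X) 1) := by
      rw [hp]
      conv_lhs => rw [← Equiv.sum_comp (Equiv.mulRight (phiH a))]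
      rw [Finset.smul_sum]
      refine Finset.sum_congr rfl fun g _ => ?_
      simp only [Equiv.coe_mulRight, act_mul, (act_hat_eq_iff a X).2 ha, map_mul, Units.val_mul,
        smul_smul, mul_comm]
    have h2 : (1 - starRingEnd ℂ (χ.1 (phiH a) : ℂ)) • p χ (Finsupp.single (hat X) 1) = 0 := by
      rw [sub_smul, one_smul, ← h1, sub_self]
    rcases smul_eq_zero.1 h2 with h3 | h3
    · exfalso
      apply hne
      have h4 := congrArg (starRingEnd ℂ) (sub_eq_zero.1 h3)
      simp only [map_one, Complex.conj_conj] at h4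
      exact Units.ext h4.symm
    · exact h3
  · intro h h0
    have h1 := DFunLike.congr_fun h0 (hat X)
    rw [hp, Finsupp.finsetSum_apply] at h1
    have h2 : ∀ g : H F n, (starRingEnd ℂ (χ.1 g : ℂ) •
        Finsupp.single (act g (hat X)) (1 : ℂ)) (hat X) =
        if act g (hat X) = hat X then 1 else 0 := by
      intro g
      obtain ⟨a, rfl⟩ := phiH_surjective g
      by_cases ha : act (phiH a) (hat X) = hat X
      · simp [ha, h a ((act_hat_eq_iff a X).1 ha)]
      · simp [ha]
    rw [Finset.sum_congr rfl fun g _ => h2 g, Finset.sum_boole] at h1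
    have h3 : (1 : H F n) ∈ Finset.univ.filter fun g : H F n => act g (hat X) = hat X := by
      simp [act_one]
    have h4 := Finset.card_pos.2 ⟨_, h3⟩
    simp only [Finsupp.coe_zero, Pi.zero_apply, Nat.cast_eq_zero] at h1
    omega

theorem exists_dotProduct [Fintype F] {n : ℕ} (ψ : AddChar F ℂ) (hψ : ψ.IsPrimitive)
    (η : AddChar (Fin n → F) ℂ) : ∃ c : Fin n → F, ∀ a, η a = ψ (c ⬝ᵥ a) := by
  classical
  let Φ : (Fin n → F) → AddChar (Fin n → F) ℂ := fun c =>
    { toFun := fun a => ψ (c ⬝ᵥ a)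
      map_zero_eq_one' := by simp
      map_add_eq_mul' := fun a b => by rw [dotProduct_add, AddChar.map_add_eq_mul] }
  have hinj : Function.Injective Φ := by
    intro c d hcd
    funext i
    apply AddChar.to_mulShift_inj_of_isPrimitive hψ
    ext t
    have h := DFunLike.congr_fun hcd (Pi.single i t)
    simpa [Φ] using h
  have hsurj : Function.Surjective Φ :=
    ((Fintype.bijective_iff_injective_and_card Φ).2 ⟨hinj, AddChar.card_eq.symm⟩).2
  obtain ⟨c, hc⟩ := hsurj η
  exact ⟨c, fun a => by rw [← hc]; rfl⟩

/-- A nontrivial character `χ` determines a hyperplane `X` by `p(χ)(hat X) ≠ 0`. -/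
theorem existsUnique_hyperplane [Fintype F] {m : ℕ} (χ : N F (m + 1)) :
    ∃! X : B F (m + 1), finrank F X = m ∧ p χ (Finsupp.single (hat X) 1) ≠ 0 := by
  simp only [p_hat_ne_zero_iff]
  have hψ := AddChar.FiniteField.primitiveChar_to_Complex_isPrimitive F
  let η : AddChar (Fin (m + 1) → F) ℂ :=
    { toFun := fun a => (χ.1 (phiH a) : ℂ)
      map_zero_eq_one' := by simp [phiH_zero]
      map_add_eq_mul' := fun a b => by simp [phiH_add] }
  obtain ⟨c, hc⟩ := exists_dotProduct _ hψ η
  have hχ : ¬ ∀ a, χ.1 (phiH a) = 1 := by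
    intro h
    apply χ.2
    ext g
    obtain ⟨a, rfl⟩ := phiH_surjective g
    simp [h a]
  refine existsUnique_of_exists_of_unique ⟨LinearMap.ker (dotProductBilin F F c), ?_, ?_⟩ ?_
  · have hne : (dotProductBilin F F c : (Fin (m + 1) → F) →ₗ[F] F) ≠ 0 := by
      intro h0
      apply hχ
      intro a
      have h1 : c ⬝ᵥ a = 0 := DFunLike.congr_fun h0 a
      have h2 := hc a
      rw [h1, AddChar.map_zero_eq_one] at h2
      exact Units.ext h2
    have h3 := Module.Dual.finrank_ker_add_one_of_ne_zero hne
    simp only [finrank_fin_fun] at h3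
    omega
  · intro a ha
    have h1 : c ⬝ᵥ a = 0 := ha
    have h2 := hc a
    rw [h1, AddChar.map_zero_eq_one] at h2
    exact Units.ext h2
  · rintro X Y ⟨hX, hX1⟩ ⟨hY, hY1⟩
    by_contra hXY
    have hlt : X < X ⊔ Y := by
      refine lt_of_le_of_ne le_sup_left fun h => hXY ?_
      have hYX : Y ≤ X := h ▸ le_sup_right
      exact (Submodule.eq_of_le_of_finrank_eq hYX (hY.trans hX.symm)).symm
    have h1 := Submodule.finrank_lt_finrank_of_lt hlt
    have h2 : X ⊔ Y = ⊤ := by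
      apply Submodule.eq_top_of_finrank_eq
      have h3 := Submodule.finrank_le (X ⊔ Y)
      rw [finrank_fin_fun] at h3 ⊢
      omega
    apply hχ
    intro a
    have ha : a ∈ X ⊔ Y := h2 ▸ Submodule.mem_top
    obtain ⟨x, hx, y, hy, rfl⟩ := Submodule.mem_sup.1 ha
    rw [phiH_add, map_mul, hX1 x hx, hY1 y hy, mul_one]

/-- The hyperplane `X(χ)`: the unique `X ∈ B_q(n, n - 1)` with `p(χ)(hat X) ≠ 0`, `n = m + 1`. -/
noncomputable def hyperplane [Fintype F] {m : ℕ} (χ : N F (m + 1)) : B F (m + 1) :=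
  (existsUnique_hyperplane χ).choose

theorem finrank_hyperplane [Fintype F] {m : ℕ} (χ : N F (m + 1)) :
    finrank F (hyperplane χ) = m :=
  (existsUnique_hyperplane χ).choose_spec.1.1

/-! ### Schubert normal form -/

/-- Schubert normal form: the last nonzero entry of column `j` is a `1` in row `r j`, the rows
`r j` increase, and they carry an identity matrix. -/
def IsSchubert {n k : ℕ} (M : Matrix (Fin n) (Fin k) F) : Prop :=
  ∃ r : Fin k → Fin n, StrictMono r ∧ (∀ j i, r j < i → M i j = 0) ∧
    ∀ j j', M (r j) j' = if j = j' then 1 else 0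

/-- The rows at which some vector of `X` has its last nonzero entry. -/
def pivots {n : ℕ} (X : B F n) : Set (Fin n) :=
  {i | ∃ x ∈ X, x i = 1 ∧ ∀ j, i < j → x j = 0}

theorem exists_pivot {n : ℕ} {X : B F n} {x : Fin n → F} (hx : x ∈ X) {i : Fin n}
    (hi : x i ≠ 0) : ∃ l ∈ pivots X, i ≤ l ∧ x l ≠ 0 := by
  classical
  let S : Finset (Fin n) := Finset.univ.filter fun l => x l ≠ 0
  have hS : S.Nonempty := ⟨i, by simpa [S] using hi⟩
  have hm : x (S.max' hS) ≠ 0 := by simpa [S] using S.max'_mem hS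
  refine ⟨S.max' hS, ⟨(x (S.max' hS))⁻¹ • x, X.smul_mem _ hx, ?_, ?_⟩,
    S.le_max' i (by simpa [S] using hi), hm⟩
  · simp [hm]
  · intro j hj
    have : x j = 0 := by
      by_contra h
      exact absurd (S.le_max' j (by simpa [S] using h)) (not_le.2 hj)
    simp [this]

theorem schubert_apply {n k : ℕ} {M : Matrix (Fin n) (Fin k) F} {r : Fin k → Fin n}
    (h : ∀ j j', M (r j) j' = if j = j' then 1 else 0) (c : Fin k → F) (j : Fin k) :
    M.mulVec c (r j) = c j := by
  simp [Matrix.mulVec, dotProduct, h]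

theorem range_eq_pivots {n k : ℕ} {M : Matrix (Fin n) (Fin k) F} {r : Fin k → Fin n}
    (h1 : ∀ j i, r j < i → M i j = 0) (h2 : ∀ j j', M (r j) j' = if j = j' then 1 else 0) :
    Set.range r = pivots (LinearMap.range M.mulVecLin) := by
  ext i
  constructor
  · rintro ⟨j, rfl⟩
    refine ⟨M.mulVec (Pi.single j 1), ⟨_, rfl⟩, ?_, ?_⟩
    · simp [h2]
    · intro i hi
      simp [h1 j i hi]
  · rintro ⟨_, ⟨c, rfl⟩, hi, hlast⟩
    simp only [Matrix.mulVecLin_apply] at hi hlast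
    have hne : ∑ j, M i j * c j ≠ 0 := by
      have : M.mulVec c i = ∑ j, M i j * c j := rfl
      rw [← this, hi]
      exact one_ne_zero
    obtain ⟨j, -, hj⟩ := Finset.exists_ne_zero_of_sum_ne_zero hne
    refine ⟨j, ?_⟩
    rcases lt_trichotomy (r j) i with h | h | h
    · exact absurd (by rw [h1 j i h, zero_mul]) hj
    · exact h
    · have := hlast _ h
      rw [schubert_apply h2] at this
      exact absurd (by rw [this, mul_zero]) hj

/-- Every subspace is the column space of a unique matrix in Schubert normal form. -/
theorem existsUnique_schubert {n k : ℕ} (X : B F n) (hX : finrank F X = k) :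
    ∃! M : Matrix (Fin n) (Fin k) F, IsSchubert M ∧ LinearMap.range M.mulVecLin = X := by
  classical
  refine existsUnique_of_exists_of_unique ?_ ?_
  · let π : X →ₗ[F] (pivots X → F) := (LinearMap.funLeft F F Subtype.val) ∘ₗ X.subtype
    have hπ : ∀ (x : X) (i : pivots X), π x i = x.1 i.1 := fun _ _ => rfl
    have hinj : Function.Injective π := by
      rw [← LinearMap.ker_eq_bot, LinearMap.ker_eq_bot']
      intro x hx
      ext i
      by_contra hi
      obtain ⟨l, hl, -, hne⟩ := exists_pivot x.2 hi
      exact hne (congrFun hx ⟨l, hl⟩)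
    have hle : Fintype.card (pivots X) ≤ finrank F X := by
      choose y hyX hy1 hy0 using fun i : pivots X => i.2
      have hli : LinearIndependent F fun i : pivots X => (⟨y i, hyX i⟩ : X) := by
        rw [Fintype.linearIndependent_iff]
        intro c hc
        by_contra! hne
        let S : Finset (pivots X) := Finset.univ.filter fun i => c i ≠ 0
        have hS : S.Nonempty := hne.imp fun i hi => by simpa [S] using hi
        have hm : c (S.max' hS) ≠ 0 := by simpa [S] using S.max'_mem hS
        have h1 := congrFun (congrArg Subtype.val hc) (S.max' hS).1
        simp only [AddSubmonoidClass.coe_finsetSum, Finset.sum_apply, Submodule.coe_smul,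
          Pi.smul_apply, smul_eq_mul, ZeroMemClass.coe_zero, Pi.zero_apply] at h1
        rw [Finset.sum_eq_single (S.max' hS)] at h1
        · rw [hy1, mul_one] at h1
          exact hm h1
        · intro j _ hj
          rcases lt_or_gt_of_ne hj with h | h
          · rw [hy0 j _ h, mul_zero]
          · have : c j = 0 := by
              by_contra hcj
              exact absurd (S.le_max' j (by simpa [S] using hcj)) (not_le.2 h)
            rw [this, zero_mul]
        · simp
      exact hli.fintype_card_le_finrank
    have hcard : Fintype.card (pivots X) = k := by
      have := LinearMap.finrank_le_finrank_of_injective hinj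
      rw [Module.finrank_fintype_fun_eq_card] at this
      omega
    have hsurj : Function.Surjective π := by
      refine (LinearMap.injective_iff_surjective_of_finrank_eq_finrank ?_).1 hinj
      rw [Module.finrank_fintype_fun_eq_card]
      omega
    let r : Fin k ≃o pivots X := Fintype.orderIsoFinOfCardEq _ hcard
    choose y hy using fun j : Fin k => hsurj (Pi.single (r j) 1)
    have hyr : ∀ j j', (y j').1 (r j).1 = if j = j' then 1 else 0 := by
      intro j j'
      rw [← hπ, hy, Pi.single_apply]
      simp
    refine ⟨Matrix.of fun i j => (y j).1 i, ⟨fun j => (r j).1, fun a b h => r.strictMono h,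
      ?_, hyr⟩, ?_⟩
    · intro j i hi
      by_contra hne
      obtain ⟨l, hl, hil, hl0⟩ := exists_pivot (y j).2 hne
      obtain ⟨j', hj'⟩ := r.surjective ⟨l, hl⟩
      have hl' : (r j').1 = l := congrArg Subtype.val hj'
      have h2 := hyr j' j
      rw [hl'] at h2
      rw [h2] at hl0
      have h3 : j' = j := by
        by_contra h
        simp [h] at hl0
      rw [h3] at hl'
      exact absurd (hi.trans_le hil) (not_lt.2 hl'.ge)
    · have hcomb : ∀ c : Fin k → F,
          (Matrix.of fun i j => (y j).1 i : Matrix (Fin n) (Fin k) F).mulVec c =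
            (∑ j, c j • y j : X).1 := by
        intro c
        funext i
        simp [Matrix.mulVec, dotProduct, mul_comm]
      apply le_antisymm
      · rintro _ ⟨c, rfl⟩
        rw [Matrix.mulVecLin_apply, hcomb]
        exact Subtype.property _
      · intro x hx
        refine ⟨fun j => x (r j).1, ?_⟩
        rw [Matrix.mulVecLin_apply, hcomb]
        have : (∑ j, x (r j).1 • y j : X) = ⟨x, hx⟩ := by
          apply hinj
          funext i
          obtain ⟨j, rfl⟩ := r.surjective i
          rw [map_sum, Finset.sum_apply]
          have h1 : ∀ j', π (x (r j').1 • y j') (r j) =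
              if j = j' then x (r j').1 else 0 := by
            intro j'
            rw [map_smul, Pi.smul_apply, hπ, hyr, smul_eq_mul, mul_ite, mul_one, mul_zero]
          rw [Finset.sum_congr rfl fun j' _ => h1 j', Finset.sum_ite_eq,
            if_pos (Finset.mem_univ j), hπ]
        rw [this]
  · rintro M M' ⟨⟨r, hr, h1, h2⟩, hM⟩ ⟨⟨r', hr', h1', h2'⟩, hM'⟩
    have hrr : r = r' := by
      refine (StrictMono.range_inj hr hr').1 ?_
      rw [range_eq_pivots h1 h2, range_eq_pivots h1' h2', hM, hM']
    subst hrr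
    ext i j
    have hmem : M'.mulVec (Pi.single j 1) ∈ LinearMap.range M.mulVecLin := by
      rw [hM, ← hM']
      exact ⟨_, rfl⟩
    obtain ⟨c, hc⟩ := hmem
    rw [Matrix.mulVecLin_apply] at hc
    have hcj : c = Pi.single j 1 := by
      funext l
      rw [← schubert_apply h2 c l, hc, schubert_apply h2']
    rw [hcj] at hc
    simpa using congrFun hc i

/-- The matrix `M(X)` in Schubert normal form with column space `X`. -/
noncomputable def schubert {n k : ℕ} (X : B F n) (hX : finrank F X = k) :
    Matrix (Fin n) (Fin k) F :=
  (existsUnique_schubert X hX).choose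

/-- `τ(X)` for `X = X(χ)`: the isomorphism from `F ^ (n - 1)` onto `X` taking the standard basis
to the columns of `M(X)`, regarded as an injective map to `F ^ n`; here `n = m + 1`. -/
noncomputable def tau [Fintype F] {m : ℕ} (χ : N F (m + 1)) :
    (Fin m → F) →ₗ[F] (Fin (m + 1) → F) :=
  (schubert (hyperplane χ) (finrank_hyperplane χ)).mulVecLin

/-- `μ(X)` for `X = X(χ)`: a subspace `Y` of `F ^ (n - 1)` goes to the subspace `τ(X)(Y)` of `X`.
The space `ℂ[B_q(X)]` is regarded as a subspace of `ℂ[B_q(n)]`. -/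
noncomputable def mu [Fintype F] {m : ℕ} (χ : N F (m + 1)) : CB F m →ₗ[ℂ] CB F (m + 1) :=
  Finsupp.linearCombination ℂ fun Y => Finsupp.single (Y.map (tau χ)) 1

/-- `λ(χ)`: `Y ↦ q ^ (-dim Y) p(χ)(hat Y)`. The same formula is used for all subspaces `Y` of
`F ^ n`, whether or not they lie in `X(χ)`; only those in `X(χ)` are ever needed. -/
noncomputable def lam [Fintype F] {n : ℕ} (χ : N F n) : CB F n →ₗ[ℂ] CB F (n + 1) :=
  Finsupp.linearCombination ℂ fun Y =>
    (q F ^ finrank F Y)⁻¹ • p χ (Finsupp.single (hat Y) 1)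

/-! ### The eigenvectors -/

/-- `E_q(n)`: the sequences built from the empty sequence by appending `0` or `1` (which raises
`n` by one), or an element of `N_q(n + 1)` (which raises `n` to `n + 2`). -/
inductive E (F : Type u) [Field F] : ℕ → Type u
  | nil : E F 0
  | zero {n : ℕ} (β : E F n) : E F (n + 1)
  | one {n : ℕ} (β : E F n) : E F (n + 1)
  | char {n : ℕ} (β : E F n) (χ : N F (n + 1)) : E F (n + 2)

/-- The number `N(α)` of nonzero entries of `α`; it is at most `n` for `α ∈ E_q(n)`. -/
def E.count : {n : ℕ} → E F n → ℕ
  | _, .nil => 0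
  | _, .zero β => β.count
  | _, .one β => β.count + 1
  | _, .char β _ => β.count + 1

theorem E.count_le : {n : ℕ} → (α : E F n) → α.count ≤ n
  | _, .nil => le_rfl
  | _, .zero β => Nat.le_succ_of_le β.count_le
  | _, .one β => Nat.succ_le_succ β.count_le
  | _, .char β _ => Nat.succ_le_succ (Nat.le_succ_of_le β.count_le)

/-- The sequence obtained from `α` by interchanging the entries `0` and `1`. -/
def E.swap : {n : ℕ} → E F n → E F n
  | _, .nil => .nil
  | _, .zero β => .one β.swap
  | _, .one β => .zero β.swap
  | _, .char β χ => .char β.swap χ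

/-- The eigenvectors `v_α`. -/
noncomputable def vec [Fintype F] : {n : ℕ} → E F n → CB F n
  | _, .nil => Finsupp.single ⊥ 1
  | _, .zero (n := n) β => q F ^ β.count • incl n (vec β) + theta n (vec β)
  | _, .one (n := n) β => q F ^ (n - β.count) • incl n (vec β) - theta n (vec β)
  | _, .char β χ => lam χ (mu χ (vec β))

end QCube

open QCube

open QCube

namespace QCube

open Module

universe u

variable {F : Type u} [Field F]

/-! A subspace `Y` of F^(n+1) not contained in the hyperplane F^n is determined by its trace `res Y`
on F^n and by one vector `(a, 1)` in it; the admissible `a` form a coset of `res Y`. Equivalently,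
the subspaces with trace `X` are the H-translates `act (phiH a) (hat X)`, and they are the covers of
`X` outside F^n (`act_hat_eq_iff_res`, `up_covBy_iff`). So `theta n v` takes the value `v (res Y)`
at such `Y`, which gives the coordinates in (a). For lengths, the weight of `up X` is that of `X`
over 1 + q^n, and a subspace with trace `X` has q^(dim X) times that weight. There are q^(n - dim X)
of these, so together they contribute a factor q^n whatever `X` is. Multiplying by r on F^n
therefore multiplies the square length by (q^n + r^2)/(1 + q^n) (`innerPi_self_of_norm_eq`), with r
= q^k or q^(n-k) in (a). For (b), χ is trivial on X(χ). For W inside X(χ), the sum defining p(χ) is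
thus constant on each coset of W, and after division by q^(dim W) only a root of unity is left
(`lam_mu_apply_of_mem`). The length is the case r = 0 applied to `mu χ v`, whose own length comes
from `innerPi_mu`. Part (c) is an induction: the two counts add up to n, so swapping exchanges the
factors q^k and q^(n-k), and lengths depend only on absolute values. -/

theorem q_ne_zero [Fintype F] : q F ≠ 0 := Nat.cast_ne_zero.2 Fintype.card_ne_zero

theorem one_add_q_pow_ne_zero {F : Type*} [Fintype F] (n : ℕ) : 1 + q F ^ n ≠ 0 := by
  rw [q]
  norm_cast
  omega

theorem P_succ {F : Type*} [Fintype F] (n : ℕ) : P F (n + 1) = P F n * (1 + q F ^ n) :=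
  Finset.prod_range_succ _ _

theorem norm_q_pow {F : Type*} [Fintype F] (k : ℕ) : ‖q F ^ k‖ = (Fintype.card F : ℝ) ^ k := by
  simp [q]

/-! ### Subspaces of F^(n+1) relative to the hyperplane F^n -/

theorem emb_castSucc {n : ℕ} (a : Fin n → F) (i : Fin n) : emb F n a i.castSucc = a i := by
  simp [emb]

theorem emb_init {n : ℕ} {y : Fin (n + 1) → F} (hy : y (Fin.last n) = 0) :
    emb F n (Fin.init y) = y := by
  funext i
  refine Fin.lastCases ?_ (fun j => ?_) i
  · rw [emb_last, hy]
  · rw [emb_castSucc, Fin.init]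

theorem mem_res {n : ℕ} {Y : B F (n + 1)} {x : Fin n → F} : x ∈ res Y ↔ emb F n x ∈ Y := Iff.rfl

theorem mem_hyper {n : ℕ} {y : Fin (n + 1) → F} : y ∈ hyper F n ↔ y (Fin.last n) = 0 :=
  ⟨by rintro ⟨x, rfl⟩; exact emb_last x, fun h => ⟨_, emb_init h⟩⟩

theorem lastVec_last (n : ℕ) : lastVec F n (Fin.last n) = 1 := by simp [lastVec]

theorem lastVec_castSucc {n : ℕ} (i : Fin n) : lastVec F n i.castSucc = 0 := by
  simp [lastVec]

theorem emb_sub_smul {n : ℕ} (y : Fin (n + 1) → F) (a : Fin n → F) :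
    emb F n (Fin.init y - y (Fin.last n) • a) =
      y - y (Fin.last n) • (emb F n a + lastVec F n) := by
  funext i
  refine Fin.lastCases ?_ (fun j => ?_) i
  · simp [emb_last, lastVec_last]
  · simp [emb_castSucc, lastVec_castSucc, Fin.init]

theorem res_up {n : ℕ} (X : B F n) : res (up X) = X :=
  Submodule.comap_map_eq_of_injective (emb_injective n) X

theorem up_le_hyper {n : ℕ} (X : B F n) : up X ≤ hyper F n := LinearMap.map_le_range

theorem up_res {n : ℕ} {Y : B F (n + 1)} (hY : Y ≤ hyper F n) : up (res Y) = Y :=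
  Submodule.map_comap_eq_self hY

theorem up_eq_iff {n : ℕ} {X : B F n} {Y : B F (n + 1)} (hY : Y ≤ hyper F n) :
    up X = Y ↔ X = res Y :=
  ⟨fun h => by rw [← h, res_up], fun h => by rw [h, up_res hY]⟩

theorem finrank_up {n : ℕ} (X : B F n) : finrank F (up X) = finrank F X :=
  (Submodule.equivMapOfInjective _ (emb_injective n) X).finrank_eq.symm

theorem exists_emb_add_lastVec_mem {n : ℕ} {Y : B F (n + 1)} (hY : ¬ Y ≤ hyper F n) :
    ∃ a : Fin n → F, emb F n a + lastVec F n ∈ Y := by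
  obtain ⟨y, hy, hne⟩ := SetLike.not_le_iff_exists.1 hY
  rw [mem_hyper] at hne
  refine ⟨(y (Fin.last n))⁻¹ • Fin.init y, ?_⟩
  have : emb F n ((y (Fin.last n))⁻¹ • Fin.init y) + lastVec F n = (y (Fin.last n))⁻¹ • y := by
    funext i
    refine Fin.lastCases ?_ (fun j => ?_) i
    · simp [emb_last, lastVec_last, hne]
    · simp [emb_castSucc, lastVec_castSucc, Fin.init]
  rw [this]
  exact Y.smul_mem _ hy

theorem not_le_hyper_of_mem {n : ℕ} {Y : B F (n + 1)} {a : Fin n → F}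
    (ha : emb F n a + lastVec F n ∈ Y) : ¬ Y ≤ hyper F n := fun h => by
  have := mem_hyper.1 (h ha)
  simp [emb_last, lastVec_last] at this

/-- Subtracting the multiple of `(a, 1)` with the same last coordinate moves `y` into F^n. Hence `Y`
is recovered from its trace and a single `a`. -/
theorem mem_iff_of_emb_add_lastVec_mem {n : ℕ} {Y : B F (n + 1)} {a : Fin n → F}
    (ha : emb F n a + lastVec F n ∈ Y) (y : Fin (n + 1) → F) :
    y ∈ Y ↔ Fin.init y - y (Fin.last n) • a ∈ res Y := by
  rw [mem_res, emb_sub_smul, Submodule.sub_mem_iff_left _ (Y.smul_mem _ ha)]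

/-! ### Translates of `hat X` under H -/

theorem emb_add_lastVec_mem_act {n : ℕ} (a : Fin n → F) (X : B F n) :
    emb F n a + lastVec F n ∈ act (phiH a) (hat X) := by
  have := mem_act_phiH a (hat X) (lastVec_mem_hat X)
  rwa [lastVec_last, one_smul, add_comm (lastVec F n)] at this

/-- `phiMatrix a` fixes F^n pointwise and preserves last coordinates, so translation does not change
the trace. -/
theorem res_act_hat {n : ℕ} (a : Fin n → F) (X : B F n) :
    res (act (phiH a) (hat X)) = X := by
  ext x
  constructor
  · rintro ⟨y, hy, hyx⟩
    replace hyx : (phiMatrix a).mulVec y = emb F n x := hyx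
    rw [phiMatrix_mulVec] at hyx
    have h := congrFun hyx (Fin.last n)
    simp only [Pi.add_apply, Pi.smul_apply, emb_last, smul_zero, add_zero] at h
    rw [h, zero_smul, add_zero] at hyx
    rw [hyx] at hy
    exact emb_mem_hat.1 hy
  · intro hx
    have := mem_act_phiH a (hat X) (emb_mem_hat.2 hx)
    rwa [emb_last, zero_smul, add_zero] at this

/-- Both sides have the same trace and share the vector `(a, 1)`, which together determine a
subspace. -/
theorem act_hat_eq_iff_res {n : ℕ} (a : Fin n → F) (X : B F n) (Y : B F (n + 1)) :
    act (phiH a) (hat X) = Y ↔ X = res Y ∧ emb F n a + lastVec F n ∈ Y := by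
  constructor
  · rintro rfl
    exact ⟨(res_act_hat a X).symm, emb_add_lastVec_mem_act a X⟩
  · rintro ⟨rfl, ha⟩
    ext y
    rw [mem_iff_of_emb_add_lastVec_mem ha,
      mem_iff_of_emb_add_lastVec_mem (emb_add_lastVec_mem_act a _), res_act_hat]

/-- H acts freely on the line `hat ⊥`: its translate by `phiH a` is spanned by `(a, 1)`. -/
theorem phiH_injective (n : ℕ) : Function.Injective (phiH (F := F) (n := n)) := by
  intro a b h
  have h1 := emb_add_lastVec_mem_act a (⊥ : B F n)
  rw [h, mem_iff_of_emb_add_lastVec_mem (emb_add_lastVec_mem_act b _), res_act_hat] at h1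
  rw [Submodule.mem_bot, sub_eq_zero] at h1
  funext i
  simpa [Fin.init, emb_castSucc, lastVec_castSucc, emb_last, lastVec_last] using congrFun h1 i

/-- The parametrization of `H(n + 1, F)` by `F ^ n`. -/
noncomputable def phiEquiv (F : Type u) [Field F] (n : ℕ) : (Fin n → F) ≃ H F n :=
  Equiv.ofBijective phiH ⟨phiH_injective n, phiH_surjective⟩

/-! ### Covers and dimensions outside the hyperplane -/

theorem up_covBy_iff {n : ℕ} {X : B F n} {Y : B F (n + 1)} (hY : ¬ Y ≤ hyper F n) :
    up X ⋖ Y ↔ X = res Y := by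
  constructor
  · intro h
    by_contra hne
    have h1 : X ≤ res Y := Submodule.map_le_iff_le_comap.1 h.le
    have h2 : up X < up (res Y) := by
      refine lt_of_le_of_ne (Submodule.map_mono h1) fun h3 => hne ?_
      rw [← res_up X, h3, res_up]
    refine h.2 h2 (lt_of_le_of_ne (Submodule.map_comap_le _ _) fun h3 => hY ?_)
    rw [← h3]
    exact up_le_hyper _
  · rintro rfl
    refine ⟨lt_of_le_of_ne (Submodule.map_comap_le _ _) fun h3 => hY ?_, fun Z hZ hZY => ?_⟩
    · rw [← h3]
      exact up_le_hyper _
    -- An intermediate `Z` inside F^n would lie in the trace of `Y`; one outside F^n shares some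
    -- `(a, 1)` with `Y` and contains the trace of `Y`, so it is all of `Y`.
    · have hZh : ¬ Z ≤ hyper F n := by
        intro hZh
        rw [← up_res hZh] at hZ
        exact hZ.not_ge (Submodule.map_mono (Submodule.comap_mono hZY.le))
      obtain ⟨a, ha⟩ := exists_emb_add_lastVec_mem hZh
      refine hZY.not_ge fun y hy => ?_
      rw [mem_iff_of_emb_add_lastVec_mem (hZY.le ha)] at hy
      rw [mem_iff_of_emb_add_lastVec_mem ha]
      exact hZ.le ⟨_, hy, rfl⟩

/-- Rank-nullity for the last-coordinate functional on `Y`, whose kernel is a copy of `res Y`. -/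
theorem finrank_of_not_le_hyper {n : ℕ} {Y : B F (n + 1)} (hY : ¬ Y ≤ hyper F n) :
    finrank F Y = finrank F (res Y) + 1 := by
  obtain ⟨a, ha⟩ := exists_emb_add_lastVec_mem hY
  let f : Module.Dual F Y := (LinearMap.proj (Fin.last n)).comp Y.subtype
  have hf : f ≠ 0 := fun h => by
    have : (emb F n a + lastVec F n) (Fin.last n) = 0 := DFunLike.congr_fun h ⟨_, ha⟩
    simp [emb_last, lastVec_last] at this
  rw [← Module.Dual.finrank_ker_add_one_of_ne_zero hf]
  congr 1
  let g : res Y →ₗ[F] Y := (emb F n).restrict fun _ h => h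
  have hg : Function.Injective g := fun x y h =>
    Subtype.ext (emb_injective n (congrArg Subtype.val h))
  rw [← LinearMap.finrank_range_of_inj hg]
  have : LinearMap.range g = LinearMap.ker f := by
    ext ⟨y, hy⟩
    constructor
    · rintro ⟨x, hx⟩
      have h1 : emb F n x.1 = y := congrArg Subtype.val hx
      change y (Fin.last n) = 0
      rw [← h1, emb_last]
    · intro h
      have h1 : y (Fin.last n) = 0 := h
      refine ⟨⟨Fin.init y, ?_⟩, Subtype.ext (emb_init h1)⟩
      rwa [mem_res, emb_init h1]
  rw [this]

/-! ### Counting, and the coordinates of `incl n v` and `theta n v` -/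

open Classical in
theorem incl_apply {n : ℕ} (v : CB F n) (Y : B F (n + 1)) :
    incl n v Y = if Y ≤ hyper F n then v (res Y) else 0 := by
  induction v using Finsupp.induction_linear with
  | zero => simp
  | add v w hv hw => rw [map_add, Finsupp.add_apply, hv, hw]; split_ifs <;> simp
  | single X c =>
    rw [incl, Finsupp.linearCombination_single, Finsupp.smul_apply, Finsupp.single_apply,
      Finsupp.single_apply]
    by_cases h : Y ≤ hyper F n
    · simp [h, up_eq_iff h]
    · have h1 : up X ≠ Y := fun h1 => h (h1 ▸ up_le_hyper X)
      simp [h, h1]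

/-- A character counts once in each sequence, matching the two by which it raises `n`. -/
theorem E.count_add_count_swap : {n : ℕ} → (α : E F n) → α.count + α.swap.count = n
  | _, .nil => rfl
  | _, .zero β => by rw [E.swap, E.count, E.count, ← add_assoc, β.count_add_count_swap]
  | _, .one β => by rw [E.swap, E.count, E.count, add_right_comm, β.count_add_count_swap]
  | _, .char β _ => by
    rw [E.swap, E.count, E.count, add_add_add_comm, β.count_add_count_swap]

section Finite

variable [Fintype F]

open Classical in
-- The set is a coset of `res Y`.
theorem card_filter_emb_add_lastVec_mem {n : ℕ} {Y : B F (n + 1)} (hY : ¬ Y ≤ hyper F n) :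
    ((Finset.univ.filter fun a : Fin n → F => emb F n a + lastVec F n ∈ Y).card : ℂ) =
      q F ^ finrank F (res Y) := by
  obtain ⟨b, hb⟩ := exists_emb_add_lastVec_mem hY
  have hiff : ∀ a : Fin n → F, emb F n a + lastVec F n ∈ Y ↔ a - b ∈ res Y := by
    intro a
    rw [mem_res, map_sub, ← Submodule.sub_mem_iff_left _ hb, add_sub_add_right_eq_sub]
  let e : {a : Fin n → F // emb F n a + lastVec F n ∈ Y} ≃ res Y :=
    (Equiv.subRight b).subtypeEquiv hiff
  rw [← Fintype.card_subtype, Fintype.card_congr e, Module.card_eq_pow_finrank (K := F)]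
  simp [q]

open Classical in
theorem theta_apply {n : ℕ} (v : CB F n) (Y : B F (n + 1)) :
    theta n v Y = if Y ≤ hyper F n then 0 else v (res Y) := by
  induction v using Finsupp.induction_linear with
  | zero => simp
  | add v w hv hw => rw [map_add, Finsupp.add_apply, hv, hw]; split_ifs <;> simp
  | single X c =>
    rw [theta, Finsupp.linearCombination_single, Finsupp.smul_apply, Finsupp.finsetSum_apply]
    simp only [Finsupp.single_apply]
    rw [Finset.sum_ite_eq']
    by_cases h : Y ≤ hyper F n
    · simp [h]
    · simp [h, up_covBy_iff h]

/-! ### The maps τ and μ attached to X(χ) -/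

/-- The pivot rows of the Schubert matrix form an identity, so `c` can be read off from its image.
-/
theorem tau_injective {m : ℕ} (χ : N F (m + 1)) : Function.Injective (tau χ) := by
  obtain ⟨⟨r, -, -, h⟩, -⟩ :=
    (existsUnique_schubert (hyperplane χ) (finrank_hyperplane χ)).choose_spec.1
  intro c d hcd
  funext j
  rw [← schubert_apply h c j, ← schubert_apply h d j]
  exact congrFun hcd _

theorem range_tau {m : ℕ} (χ : N F (m + 1)) : LinearMap.range (tau χ) = hyperplane χ :=
  (existsUnique_schubert (hyperplane χ) (finrank_hyperplane χ)).choose_spec.1.2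

theorem map_tau_eq_iff {m : ℕ} {χ : N F (m + 1)} {Z : B F m} {W : B F (m + 1)} :
    Z.map (tau χ) = W ↔ W ≤ hyperplane χ ∧ Z = W.comap (tau χ) := by
  constructor
  · rintro rfl
    exact ⟨range_tau χ ▸ LinearMap.map_le_range,
      (Submodule.comap_map_eq_of_injective (tau_injective χ) Z).symm⟩
  · rintro ⟨h, rfl⟩
    exact Submodule.map_comap_eq_self (range_tau χ ▸ h)

open Classical in
theorem mu_apply {m : ℕ} (χ : N F (m + 1)) (v : CB F m) (W : B F (m + 1)) :
    mu χ v W = if W ≤ hyperplane χ then v (W.comap (tau χ)) else 0 := by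
  induction v using Finsupp.induction_linear with
  | zero => simp
  | add v w hv hw => rw [map_add, Finsupp.add_apply, hv, hw]; split_ifs <;> simp
  | single Z c =>
    rw [mu, Finsupp.linearCombination_single, Finsupp.smul_apply, Finsupp.single_apply,
      Finsupp.single_apply]
    simp only [map_tau_eq_iff, ite_and, smul_eq_mul, mul_ite, mul_one, mul_zero]

/-! ### Coordinates of p(χ) and λ(χ) -/

theorem apply_phiH_eq_one {m : ℕ} {χ : N F (m + 1)} {a : Fin (m + 1) → F}
    (ha : a ∈ hyperplane χ) : χ.1 (phiH a) = 1 :=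
  (p_hat_ne_zero_iff χ _).1 (existsUnique_hyperplane χ).choose_spec.1.2 a ha

open Classical in
theorem p_hat_apply {n : ℕ} (χ : N F n) (W : B F n) (Y : B F (n + 1)) :
    p χ (Finsupp.single (hat W) 1) Y =
      ∑ a : Fin n → F, if W = res Y ∧ emb F n a + lastVec F n ∈ Y then
        starRingEnd ℂ (χ.1 (phiH a) : ℂ) else 0 := by
  rw [p, Finsupp.linearCombination_single, one_smul, Finsupp.finsetSum_apply,
    ← Equiv.sum_comp (phiEquiv F n)]
  refine Finset.sum_congr rfl fun a _ => ?_
  change (_ • Finsupp.single (act (phiH a) (hat W)) (1 : ℂ)) Y = _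
  rw [Finsupp.smul_apply, Finsupp.single_apply]
  simp only [act_hat_eq_iff_res, smul_eq_mul, mul_ite, mul_one, mul_zero]
  rfl

theorem p_hat_apply_of_le_hyper {n : ℕ} (χ : N F n) (W : B F n) {Y : B F (n + 1)}
    (hY : Y ≤ hyper F n) : p χ (Finsupp.single (hat W) 1) Y = 0 := by
  classical
  rw [p_hat_apply]
  exact Finset.sum_eq_zero fun a _ => if_neg fun h => not_le_hyper_of_mem h.2 hY

open Classical in
-- The contributing `a` form the coset b + W, on which χ is constant because it is trivial on X(χ).
theorem p_hat_apply_of_mem {m : ℕ} {χ : N F (m + 1)} {W : B F (m + 1)} (hW : W ≤ hyperplane χ)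
    {Y : B F (m + 2)} {b : Fin (m + 1) → F} (hb : emb F (m + 1) b + lastVec F (m + 1) ∈ Y) :
    p χ (Finsupp.single (hat W) 1) Y =
      if W = res Y then q F ^ finrank F W * starRingEnd ℂ (χ.1 (phiH b) : ℂ) else 0 := by
  rw [p_hat_apply]
  split_ifs with h
  · subst h
    simp only [true_and]
    rw [← Finset.sum_filter, ← card_filter_emb_add_lastVec_mem (not_le_hyper_of_mem hb),
      ← nsmul_eq_mul]
    refine Finset.sum_eq_card_nsmul fun a ha => ?_
    have h1 : a - b ∈ res Y := by
      have := sub_mem (Finset.mem_filter.1 ha).2 hb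
      rwa [add_sub_add_right_eq_sub, ← map_sub] at this
    rw [← sub_add_cancel a b, phiH_add, map_mul, apply_phiH_eq_one (hW h1), one_mul]
  · simp [h]

theorem lam_apply_of_le_hyper {n : ℕ} (χ : N F n) (v : CB F n) {Y : B F (n + 1)}
    (hY : Y ≤ hyper F n) : lam χ v Y = 0 := by
  induction v using Finsupp.induction_linear with
  | zero => simp
  | add v w hv hw => rw [map_add, Finsupp.add_apply, hv, hw, add_zero]
  | single X c =>
    rw [lam, Finsupp.linearCombination_single, Finsupp.smul_apply, Finsupp.smul_apply,
      p_hat_apply_of_le_hyper χ X hY, smul_zero, smul_zero]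

/-- The factor q^(dim W) from the coset cancels the normalization in `lam`, leaving a scalar of
absolute value 1. -/
theorem lam_mu_apply_of_mem {m : ℕ} (χ : N F (m + 1)) (v : CB F m) {Y : B F (m + 2)}
    {b : Fin (m + 1) → F} (hb : emb F (m + 1) b + lastVec F (m + 1) ∈ Y) :
    lam χ (mu χ v) Y = starRingEnd ℂ (χ.1 (phiH b) : ℂ) * mu χ v (res Y) := by
  classical
  induction v using Finsupp.induction_linear with
  | zero => simp
  | add v w hv hw => simp only [map_add, Finsupp.add_apply, hv, hw, mul_add]
  | single Z c =>
    have hW : Z.map (tau χ) ≤ hyperplane χ := (map_tau_eq_iff.1 rfl).1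
    rw [mu, Finsupp.linearCombination_single, map_smul, lam, Finsupp.linearCombination_single,
      Finsupp.smul_apply, Finsupp.smul_apply, Finsupp.smul_apply, Finsupp.smul_apply,
      p_hat_apply_of_mem hW hb, Finsupp.single_apply]
    split_ifs
    · have := pow_ne_zero (finrank F (Z.map (tau χ))) (q_ne_zero (F := F))
      simp only [smul_eq_mul]
      field_simp
    · simp

theorem norm_char_apply {n : ℕ} (χ : N F n) (g : H F n) : ‖(χ.1 g : ℂ)‖ = 1 := by
  have h : (χ.1 g : ℂ) ^ Fintype.card (H F n) = 1 := by
    rw [← Units.val_pow_eq_pow_val, ← map_pow, pow_card_eq_one, map_one, Units.val_one]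
  exact Complex.norm_eq_one_of_pow_eq_one h Fintype.card_ne_zero

theorem norm_lam_mu_apply {m : ℕ} (χ : N F (m + 1)) (v : CB F m) {Y : B F (m + 2)}
    (hY : ¬ Y ≤ hyper F (m + 1)) : ‖lam χ (mu χ v) Y‖ = ‖mu χ v (res Y)‖ := by
  obtain ⟨b, hb⟩ := exists_emb_add_lastVec_mem hY
  rw [lam_mu_apply_of_mem χ v hb, norm_mul, RCLike.norm_conj, norm_char_apply, one_mul]

/-! ### Inner products -/

open Classical in
theorem sum_le_hyper {n : ℕ} (g : B F (n + 1) → ℂ) :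
    ∑ Y : B F (n + 1), (if Y ≤ hyper F n then g Y else 0) = ∑ X : B F n, g (up X) := by
  rw [← Finset.sum_filter]
  symm
  refine Finset.sum_bij' (fun X _ => up X) (fun Y _ => res Y) ?_ ?_ ?_ ?_ ?_
  · exact fun X _ => Finset.mem_filter.2 ⟨Finset.mem_univ _, up_le_hyper X⟩
  · exact fun _ _ => Finset.mem_univ _
  · exact fun X _ => res_up X
  · exact fun Y hY => up_res (Finset.mem_filter.1 hY).2
  · exact fun _ _ => rfl

open Classical in
-- For fixed `a`, each trace `X` has exactly one extension containing `(a, 1)`, namely `act (phiH a)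
-- (hat X)`.
theorem sum_emb_add_lastVec_mem {n : ℕ} (a : Fin n → F) (f : B F n → ℂ) :
    ∑ Y : B F (n + 1), (if emb F n a + lastVec F n ∈ Y then f (res Y) else 0) =
      ∑ X : B F n, f X := by
  rw [← Finset.sum_filter]
  refine Finset.sum_bij' (fun Y _ => res Y) (fun X _ => act (phiH a) (hat X)) ?_ ?_ ?_ ?_ ?_
  · exact fun _ _ => Finset.mem_univ _
  · exact fun X _ => Finset.mem_filter.2 ⟨Finset.mem_univ _, emb_add_lastVec_mem_act a X⟩
  · exact fun Y hY => (act_hat_eq_iff_res a _ Y).2 ⟨rfl, (Finset.mem_filter.1 hY).2⟩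
  · exact fun X _ => res_act_hat a X
  · exact fun _ _ => rfl

open Classical in
-- Double count of pairs (a, Y) with `(a, 1)` in `Y`: each `Y` outside F^n has q^(dim `res Y`) such
-- `a`, and each of the q^n vectors `a` meets every trace once.
theorem sum_not_le_hyper {n : ℕ} (f : B F n → ℂ) :
    ∑ Y : B F (n + 1), (if Y ≤ hyper F n then 0 else q F ^ finrank F (res Y) * f (res Y)) =
      q F ^ n * ∑ X : B F n, f X := by
  have h : ∀ Y : B F (n + 1),
      (if Y ≤ hyper F n then 0 else q F ^ finrank F (res Y) * f (res Y)) =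
        ∑ a : Fin n → F, if emb F n a + lastVec F n ∈ Y then f (res Y) else 0 := by
    intro Y
    split_ifs with hY
    · exact (Finset.sum_eq_zero fun a _ => if_neg fun h => not_le_hyper_of_mem h hY).symm
    · rw [← Finset.sum_filter, Finset.sum_const, nsmul_eq_mul,
        card_filter_emb_add_lastVec_mem hY]
  rw [Finset.sum_congr rfl fun Y _ => h Y, Finset.sum_comm,
    Finset.sum_congr rfl fun a _ => sum_emb_add_lastVec_mem a f]
  simp [q]

theorem weight_up {n : ℕ} (X : B F n) : weight (up X) = weight X / (1 + q F ^ n) := by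
  rw [weight, weight, finrank_up, P_succ, div_div]

/-- The power of q comes from C(d+1, 2) = d + C(d, 2). -/
theorem weight_of_not_le_hyper {n : ℕ} {Y : B F (n + 1)} (hY : ¬ Y ≤ hyper F n) :
    weight Y = q F ^ finrank F (res Y) * (weight (res Y) / (1 + q F ^ n)) := by
  rw [weight, weight, finrank_of_not_le_hyper hY, P_succ, div_div, Nat.choose_succ_succ',
    Nat.choose_one_right, pow_add, mul_div_assoc]

theorem conj_mul_self (z : ℂ) : starRingEnd ℂ z * z = ((‖z‖ ^ 2 : ℝ) : ℂ) := by
  rw [Complex.conj_mul']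
  norm_cast

theorem innerPi_self {n : ℕ} (v : CB F n) :
    innerPi v v = ∑ X : B F n, ((‖v X‖ ^ 2 : ℝ) : ℂ) * weight X := by
  simp only [innerPi, conj_mul_self]

theorem innerPi_self_congr {n : ℕ} {v w : CB F n} (h : ∀ X, ‖v X‖ = ‖w X‖) :
    innerPi v v = innerPi w w := by
  simp only [innerPi_self, h]

/-- If the absolute values of `w` are those of `v`, multiplied by `r` on `B_q(n)`, then the square
length of `w` is determined by that of `v`. -/
theorem innerPi_self_of_norm_eq {n : ℕ} {v : CB F n} {w : CB F (n + 1)} {r : ℝ}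
    (h1 : ∀ Y, Y ≤ hyper F n → ‖w Y‖ = r * ‖v (res Y)‖)
    (h2 : ∀ Y, ¬ Y ≤ hyper F n → ‖w Y‖ = ‖v (res Y)‖) :
    innerPi w w = (q F ^ n + (r : ℂ) ^ 2) / (1 + q F ^ n) * innerPi v v := by
  classical
  have hsplit : ∀ Y : B F (n + 1), ((‖w Y‖ ^ 2 : ℝ) : ℂ) * weight Y =
      (if Y ≤ hyper F n then ((‖w Y‖ ^ 2 : ℝ) : ℂ) * weight Y else 0) +
      (if Y ≤ hyper F n then 0 else q F ^ finrank F (res Y) *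
        (((‖v (res Y)‖ ^ 2 : ℝ) : ℂ) * (weight (res Y) / (1 + q F ^ n)))) := by
    intro Y
    split_ifs with hY
    · rw [add_zero]
    · rw [zero_add, h2 Y hY, weight_of_not_le_hyper hY]
      ring
  rw [innerPi_self w, Finset.sum_congr rfl fun Y _ => hsplit Y, Finset.sum_add_distrib,
    sum_le_hyper, sum_not_le_hyper fun X => ((‖v X‖ ^ 2 : ℝ) : ℂ) * (weight X / (1 + q F ^ n)),
    innerPi_self, Finset.mul_sum, Finset.mul_sum, ← Finset.sum_add_distrib]
  refine Finset.sum_congr rfl fun X _ => ?_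
  rw [h1 _ (up_le_hyper X), res_up, weight_up]
  push_cast
  ring

theorem weight_map_tau {m : ℕ} (χ : N F (m + 1)) (Z : B F m) :
    weight (Z.map (tau χ)) = weight Z / (1 + q F ^ m) := by
  rw [weight, weight, ← (Submodule.equivMapOfInjective _ (tau_injective χ) Z).finrank_eq, P_succ,
    div_div]

/-- τ preserves dimensions, so the weights differ only by the last factor of `P F (m + 1)`. -/
theorem innerPi_mu {m : ℕ} (χ : N F (m + 1)) (v : CB F m) :
    innerPi (mu χ v) (mu χ v) = innerPi v v / (1 + q F ^ m) := by
  classical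
  rw [innerPi_self, innerPi_self, Finset.sum_div]
  symm
  have hinj : Function.Injective fun Z : B F m => Z.map (tau χ) :=
    Submodule.map_injective_of_injective (tau_injective χ)
  refine Finset.sum_of_injOn (fun Z => Z.map (tau χ)) hinj.injOn (fun _ _ => by simp) ?_ ?_
  · intro W _ hW
    rw [mu_apply, if_neg fun h => hW ⟨_, by simp, map_tau_eq_iff.2 ⟨h, rfl⟩⟩]
    simp
  · intro Z _
    have h := map_tau_eq_iff.1 (rfl : Z.map (tau χ) = Z.map (tau χ))
    rw [mu_apply, if_pos h.1, ← h.2, weight_map_tau, mul_div_assoc]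

/-! ### The eigenvectors -/

theorem vec_zero_apply_of_le {n : ℕ} (β : E F n) {Y : B F (n + 1)} (hY : Y ≤ hyper F n) :
    vec β.zero Y = q F ^ β.count * vec β (res Y) := by
  simp [vec, incl_apply, theta_apply, hY]

theorem vec_zero_apply_of_not_le {n : ℕ} (β : E F n) {Y : B F (n + 1)} (hY : ¬ Y ≤ hyper F n) :
    vec β.zero Y = vec β (res Y) := by
  simp [vec, incl_apply, theta_apply, hY]

theorem vec_one_apply_of_le {n : ℕ} (β : E F n) {Y : B F (n + 1)} (hY : Y ≤ hyper F n) :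
    vec β.one Y = q F ^ (n - β.count) * vec β (res Y) := by
  simp [vec, incl_apply, theta_apply, hY]

theorem vec_one_apply_of_not_le {n : ℕ} (β : E F n) {Y : B F (n + 1)} (hY : ¬ Y ≤ hyper F n) :
    vec β.one Y = -vec β (res Y) := by
  simp [vec, incl_apply, theta_apply, hY]

theorem innerPi_vec_zero {n : ℕ} (β : E F n) :
    innerPi (vec β.zero) (vec β.zero) =
      (q F ^ n + q F ^ (2 * β.count)) / (1 + q F ^ n) * innerPi (vec β) (vec β) := by
  rw [innerPi_self_of_norm_eq (v := vec β) (r := (Fintype.card F : ℝ) ^ β.count)]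
  · simp [q, pow_mul']
  · intro Y hY
    rw [vec_zero_apply_of_le β hY, norm_mul, norm_q_pow]
  · intro Y hY
    rw [vec_zero_apply_of_not_le β hY]

theorem innerPi_vec_one {n : ℕ} (β : E F n) :
    innerPi (vec β.one) (vec β.one) =
      (q F ^ n + q F ^ (2 * (n - β.count))) / (1 + q F ^ n) * innerPi (vec β) (vec β) := by
  rw [innerPi_self_of_norm_eq (v := vec β) (r := (Fintype.card F : ℝ) ^ (n - β.count))]
  · simp [q, pow_mul']
  · intro Y hY
    rw [vec_one_apply_of_le β hY, norm_mul, norm_q_pow]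
  · intro Y hY
    rw [vec_one_apply_of_not_le β hY, norm_neg]

theorem vec_char_apply_of_le {n : ℕ} (β : E F n) (χ : N F (n + 1)) {Y : B F (n + 2)}
    (hY : Y ≤ hyper F (n + 1)) : vec (E.char β χ) Y = 0 := by
  rw [vec, lam_apply_of_le_hyper χ _ hY]

theorem norm_vec_char_apply_of_not_le {n : ℕ} (β : E F n) (χ : N F (n + 1)) {Y : B F (n + 2)}
    (hY : ¬ Y ≤ hyper F (n + 1)) : ‖vec (E.char β χ) Y‖ = ‖mu χ (vec β) (res Y)‖ := by
  rw [vec, norm_lam_mu_apply χ _ hY]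

theorem innerPi_vec_char {n : ℕ} (β : E F n) (χ : N F (n + 1)) :
    innerPi (vec (E.char β χ)) (vec (E.char β χ)) =
      q F ^ (n + 1) / ((1 + q F ^ n) * (1 + q F ^ (n + 1))) * innerPi (vec β) (vec β) := by
  -- r = 0 because the vector vanishes on F^(n+1).
  rw [innerPi_self_of_norm_eq (v := mu χ (vec β)) (r := 0), innerPi_mu]
  · have h1 := one_add_q_pow_ne_zero (F := F) n
    have h2 := one_add_q_pow_ne_zero (F := F) (n + 1)
    field_simp
    simp
  · intro Y hY
    rw [vec_char_apply_of_le β χ hY, norm_zero, zero_mul]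
  · exact fun Y hY => norm_vec_char_apply_of_not_le β χ hY

theorem norm_vec_swap : {n : ℕ} → (α : E F n) → ∀ Y : B F n, ‖vec α Y‖ = ‖vec α.swap Y‖
  | _, .nil => fun _ => rfl
  | n + 1, .zero β => fun Y => by
    rw [E.swap]
    -- The exponent for an appended 1 after swapping equals the exponent for an appended 0 before
    -- it.
    have h : n - β.swap.count = β.count := by
      have := β.count_add_count_swap
      omega
    by_cases hY : Y ≤ hyper F n
    · rw [vec_zero_apply_of_le β hY, vec_one_apply_of_le β.swap hY, h, norm_mul, norm_mul,
        norm_vec_swap β]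
    · rw [vec_zero_apply_of_not_le β hY, vec_one_apply_of_not_le β.swap hY, norm_neg,
        norm_vec_swap β]
  | n + 1, .one β => fun Y => by
    rw [E.swap]
    have h : n - β.count = β.swap.count := by
      have := β.count_add_count_swap
      omega
    by_cases hY : Y ≤ hyper F n
    · rw [vec_one_apply_of_le β hY, vec_zero_apply_of_le β.swap hY, h, norm_mul, norm_mul,
        norm_vec_swap β]
    · rw [vec_one_apply_of_not_le β hY, vec_zero_apply_of_not_le β.swap hY, norm_neg,
        norm_vec_swap β]
  | n + 2, .char β χ => fun Y => by
    classical
    rw [E.swap]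
    by_cases hY : Y ≤ hyper F (n + 1)
    · rw [vec_char_apply_of_le β χ hY, vec_char_apply_of_le β.swap χ hY]
    · rw [norm_vec_char_apply_of_not_le β χ hY, norm_vec_char_apply_of_not_le β.swap χ hY,
        mu_apply, mu_apply]
      split_ifs
      · exact norm_vec_swap β _
      · rfl

end Finite

end QCube

/-- In the second part `n + 1` plays the role of the n of (b), so n ≥ 1 is built in. For `res Y`
inside X(χ), `comap (tau χ)` is the inverse image under the isomorphism τ(X). -/
theorem theorem11 {F : Type*} [Field F] [Fintype F] :
    (∀ (n : ℕ) (β : E F n) (k : ℕ), β.count = k →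
      ((∀ Y : B F (n + 1),
          (Y ≤ hyper F n → vec β.zero Y = q F ^ k * vec β (res Y)) ∧
          (¬ Y ≤ hyper F n → vec β.zero Y = vec β (res Y))) ∧
        innerPi (vec β.zero) (vec β.zero) =
          (q F ^ n + q F ^ (2 * k)) / (1 + q F ^ n) * innerPi (vec β) (vec β)) ∧
      ((∀ Y : B F (n + 1),
          (Y ≤ hyper F n → vec β.one Y = q F ^ (n - k) * vec β (res Y)) ∧
          (¬ Y ≤ hyper F n → vec β.one Y = -vec β (res Y))) ∧
        innerPi (vec β.one) (vec β.one) =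
          (q F ^ n + q F ^ (2 * (n - k))) / (1 + q F ^ n) * innerPi (vec β) (vec β))) ∧
    (∀ (n : ℕ) (β : E F n) (χ : N F (n + 1)),
      (∀ Y : B F (n + 2),
        (Y ≤ hyper F (n + 1) → ‖vec (E.char β χ) Y‖ = 0) ∧
        (¬ Y ≤ hyper F (n + 1) → res Y ≤ hyperplane χ →
          ‖vec (E.char β χ) Y‖ = ‖vec β ((res Y).comap (tau χ))‖) ∧
        (¬ Y ≤ hyper F (n + 1) → ¬ res Y ≤ hyperplane χ → ‖vec (E.char β χ) Y‖ = 0)) ∧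
      innerPi (vec (E.char β χ)) (vec (E.char β χ)) =
        q F ^ (n + 1) / ((1 + q F ^ n) * (1 + q F ^ (n + 1))) *
          innerPi (vec β) (vec β)) ∧
    (∀ (n : ℕ) (α : E F n),
      (∀ Y : B F n, ‖vec α Y‖ = ‖vec α.swap Y‖) ∧
      innerPi (vec α) (vec α) = innerPi (vec α.swap) (vec α.swap)) := by
  classical
  refine ⟨fun n β k hk => ?_, fun n β χ => ⟨fun Y => ⟨fun hY => ?_, fun hY hX => ?_,
    fun hY hX => ?_⟩, innerPi_vec_char β χ⟩,
    fun n α => ⟨norm_vec_swap α, innerPi_self_congr (norm_vec_swap α)⟩⟩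
  · subst hk
    exact ⟨⟨fun Y => ⟨vec_zero_apply_of_le β, vec_zero_apply_of_not_le β⟩, innerPi_vec_zero β⟩,
      ⟨fun Y => ⟨vec_one_apply_of_le β, vec_one_apply_of_not_le β⟩, innerPi_vec_one β⟩⟩
  · rw [vec_char_apply_of_le β χ hY, norm_zero]
  · rw [norm_vec_char_apply_of_not_le β χ hY, mu_apply, if_pos hX]
  · rw [norm_vec_char_apply_of_not_le β χ hY, mu_apply, if_neg hX, norm_zero]
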